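/- Let $\mathbb{F}_q$ be a finite field with $q$ elements, of characteristic $p \ge 5$, and let $K = \mathbb{F}_q(t)$ be the field of rational functions in one variable over $\mathbb{F}_q$. For every integer $d \ge 1$ coprime to $q$, let $E_d$ be the elliptic curve over $K$ with affine Weierstrass equation $$E_d:\quad y^2 + xy - t^d\, y = x^3 .$$ Then the torsion subgroup of the group $E_d(K)$ of $K$-rational points satisfies $E_d(K)_{\mathrm{tors}} \simeq \mathbb{Z}/3\mathbb{Z}$. More precisely, $E_d(K)_{\mathrm{tors}}$ is generated by the point $P_0 = (0,0)$. -/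

import Mathlib

noncomputable section

/-- The `d`-th Hessian curve `E_d : y² + xy - tᵈ y = x³` over the rational function field `F(t)`,
where `t = RatFunc.X`. -/
def hessianCurve (F : Type*) [Field F] (d : ℕ) : WeierstrassCurve (RatFunc F) where
  a₁ := 1
  a₂ := 0
  a₃ := -RatFunc.X ^ d
  a₄ := 0
  a₆ := 0

/-- The discriminant of the model of `E_d` is `-t³ᵈ (27 tᵈ + 1)`. -/
theorem hessianCurve_discr (F : Type*) [Field F] (d : ℕ) :
    (hessianCurve F d).Δ = -(RatFunc.X ^ (3 * d) * (27 * RatFunc.X ^ d + 1)) := by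
  simp only [hessianCurve, WeierstrassCurve.Δ, WeierstrassCurve.b₂, WeierstrassCurve.b₄,
    WeierstrassCurve.b₆, WeierstrassCurve.b₈]
  ring

/-- For `d ≥ 1` the curve `E_d` is an elliptic curve: its discriminant is nonzero. -/
theorem hessianCurve_isElliptic (F : Type*) [Field F] {d : ℕ} (hd : 1 ≤ d) :
    (hessianCurve F d).IsElliptic := by
  refine ⟨isUnit_iff_ne_zero.mpr ?_⟩
  rw [hessianCurve_discr]
  refine neg_ne_zero.mpr (mul_ne_zero (pow_ne_zero _ RatFunc.X_ne_zero) ?_)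
  have h : (27 * RatFunc.X ^ d + 1 : RatFunc F)
      = algebraMap (Polynomial F) (RatFunc F) (27 * Polynomial.X ^ d + 1) := by
    rw [map_add, map_mul, map_pow, map_one, map_ofNat, RatFunc.algebraMap_X]
  rw [h]
  refine RatFunc.algebraMap_ne_zero fun h0 => ?_
  have h1 := congrArg (Polynomial.eval 0) h0
  have hd' : d ≠ 0 := by omega
  simp [hd'] at h1

theorem hessianCurve_nonsingular_zero (F : Type*) [Field F] (d : ℕ) :
    (hessianCurve F d).toAffine.Nonsingular 0 0 := by
  rw [WeierstrassCurve.Affine.nonsingular_zero]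
  exact ⟨rfl, Or.inl (neg_ne_zero.mpr (pow_ne_zero _ RatFunc.X_ne_zero))⟩

/-- The rational point `P₀ = (0, 0)` on `E_d`. -/
def hessianPoint (F : Type*) [Field F] (d : ℕ) : (hessianCurve F d).toAffine.Point :=
  .some 0 0 (hessianCurve_nonsingular_zero F d)

end

/-!
Let `s = tᵈ`. Negation on `E_d` is `(x, y) ↦ (x, y')` with `y' = s - x - y`, so that `y y' = -x³`
and `y - y'` is the denominator of the tangent slope. A point with `x ≠ 0` is written in lowest
terms as `x = A / B²`, `y = C / B³`, `y' = C' / B³` (`HessianTriple`). The proof compares two quantities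
attached to such a point: the naive height `H = max (3 deg A) (6 deg B + 2d)`, and the depth
`i = min (ord₀ C) (ord₀ C')`, which tells how deep the point lies in the node of the special fibre
at `t = 0` (the component index, up to sign, of the fibre of type `I_{3d}`).

Doubling multiplies `H` by four, up to the cancellation in the duplication formula. At `t = ∞` no
cancellation is possible after the base change `t ↦ t³` (`four_mul_naiveHeight_le`). At a finite
place other than `t = 0` there is none either, because the discriminant `-s³ (27 s + 1)` vanishes
there to order at most one, `d` being invertible in `F`. At `t = 0` the numerator and the
denominator of the tangent slope share exactly the factor `tⁱ` (`HessianTriple.isCoprime_tangent`).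
Hence `H(2P) ≥ 4 H(P) - 6 i(P)`. On the other side, the identities
`y(2P) (y - y')³ = -y' (y + s)³` and `y'(2P) (y - y')³ = y (y' + s)³` give
`i(2P) ≤ min (2 i(P)) (3d - 2 i(P))` (`HessianTriple.nodeDepth_double`).

It follows that the defect `d H - i (3d - i)` is at least multiplied by four under doubling. A
torsion point outside `⟨P₀⟩` has finitely many multiples and all its doubles stay outside `⟨P₀⟩`,
as there is no point of order two. So its defect is at most `0`, and since `H ≥ 2d` this forces
`i ≥ d`. The same bound for `2P`, together with `i(2P) ≤ 3d - 2 i(P)`, leaves only `i = d` and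
`H = 2d`. But then `tᵈ` divides `A` while `3 deg A ≤ 2d`, which contradicts `x ≠ 0`. This treats
torsion of order prime to `p` and of order divisible by `p` alike.
-/

open Polynomial

/-! ### Order of vanishing at `t = 0` -/

section Order

variable {F : Type*} [Field F]

theorem X_pow_dvd_iff_le_natTrailingDegree {f : F[X]} (hf : f ≠ 0) {n : ℕ} :
    X ^ n ∣ f ↔ n ≤ f.natTrailingDegree := by
  rw [X_pow_dvd_iff]
  exact ⟨le_natTrailingDegree hf, fun h k hk => coeff_eq_zero_of_lt_natTrailingDegree (by omega)⟩

theorem natTrailingDegree_eq_of_X_pow_dvd_sub {f g : F[X]} (hf : f ≠ 0) (hg : g ≠ 0)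
    (h : X ^ (f.natTrailingDegree + 1) ∣ f - g) : g.natTrailingDegree = f.natTrailingDegree := by
  apply le_antisymm
  · by_contra! hlt
    have h1 : X ^ (f.natTrailingDegree + 1) ∣ g := (X_pow_dvd_iff_le_natTrailingDegree hg).2 hlt
    have h2 := (X_pow_dvd_iff_le_natTrailingDegree hf).1 ((dvd_sub_left h1).1 h)
    omega
  · apply (X_pow_dvd_iff_le_natTrailingDegree hg).1
    have h1 : X ^ f.natTrailingDegree ∣ f := (X_pow_dvd_iff_le_natTrailingDegree hf).2 le_rfl
    exact (dvd_sub_right h1).1 ((pow_dvd_pow X (Nat.le_succ _)).trans h)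

theorem natTrailingDegree_pow_three {f : F[X]} (hf : f ≠ 0) :
    (f ^ 3).natTrailingDegree = 3 * f.natTrailingDegree := by
  rw [pow_succ, pow_two, natTrailingDegree_mul (mul_ne_zero hf hf) hf,
    natTrailingDegree_mul hf hf]
  ring

end Order

/-! ### Duplication identities -/

section Identities

variable {R : Type*} [CommRing R] (A B C C' s : R)

/-- The square of the denominator `2y + x - s` of the tangent slope, as a polynomial in `x`. -/
theorem hessian_tangent_sq (ha : C + C' = s * B ^ 3 - A * B) (hm : C * C' = -A ^ 3) :
    (C - C') ^ 2 = 4 * A ^ 3 + A ^ 2 * B ^ 2 - 2 * s * A * B ^ 4 + s ^ 2 * B ^ 6 := by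
  obtain rfl : C' = s * B ^ 3 - A * B - C := by linear_combination ha
  linear_combination -4 * hm

/-- The numerator of `x(2P)`, as a polynomial in `x`. -/
theorem hessian_double_x (ha : C + C' = s * B ^ 3 - A * B) (hm : C * C' = -A ^ 3) :
    (3 * A ^ 2 - C * B) ^ 2 + (3 * A ^ 2 - C * B) * (B * (C - C')) - 2 * A * (C - C') ^ 2 =
      A * (A ^ 3 + s * A * B ^ 4 - 2 * s ^ 2 * B ^ 6) := by
  obtain rfl : C' = s * B ^ 3 - A * B - C := by linear_combination ha
  linear_combination (B ^ 2 + 8 * A) * hm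

/-- The numerator of `y'(2P)`. It factors because `y'(2P) / y` is the cube of a function with zeros
at the points `P₀ + T` and poles at `T`, where `T` runs through the points of order two. -/
theorem hessian_double_negY (ha : C + C' = s * B ^ 3 - A * B) (hm : C * C' = -A ^ 3) :
    (3 * A ^ 2 - C * B) * (A * (A ^ 3 + s * A * B ^ 4 - 2 * s ^ 2 * B ^ 6) - A * (C - C') ^ 2) +
      C * (C - C') ^ 3 = C * (C' + s * B ^ 3) ^ 3 := by
  obtain rfl : C' = s * B ^ 3 - A * B - C := by linear_combination ha
  grind

/-- The numerator of `y(2P)`; compare `hessian_double_negY`. -/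
theorem hessian_double_y (ha : C + C' = s * B ^ 3 - A * B) (hm : C * C' = -A ^ 3) :
    s * B ^ 3 * (C - C') ^ 3 -
        A * (A ^ 3 + s * A * B ^ 4 - 2 * s ^ 2 * B ^ 6) * (B * (C - C')) -
      C * (C' + s * B ^ 3) ^ 3 = -(C' * (C + s * B ^ 3) ^ 3) := by
  obtain rfl : C' = s * B ^ 3 - A * B - C := by linear_combination ha
  grind

end Identities

/-! ### Points in lowest terms and their depth at the node -/

/-- A point of `E_d` with nonzero `x`-coordinate in lowest terms: `x = A / B²`, `y = C / B³`, and
`C' / B³` is the `y`-coordinate of the opposite point. The equation of the curve is encoded in the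
sum and the product of `C` and `C'`. -/
structure HessianTriple {F : Type*} [Field F] (d : ℕ) (A B C C' : F[X]) : Prop where
  coprime : IsCoprime A B
  A_ne_zero : A ≠ 0
  B_ne_zero : B ≠ 0
  add : C + C' = X ^ d * B ^ 3 - A * B
  mul : C * C' = -A ^ 3

/-- The depth of a point in the node at `t = 0`: the smaller of the orders of vanishing of `C` and
`C'`. It is `0` precisely for the points with nonsingular reduction at `t = 0`. -/
def nodeDepth {F : Type*} [Field F] (C C' : F[X]) : ℕ :=
  min C.natTrailingDegree C'.natTrailingDegree

namespace HessianTriple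

variable {F : Type*} [Field F] {d : ℕ} {A B C C' : F[X]}

theorem symm (h : HessianTriple d A B C C') : HessianTriple d A B C' C :=
  ⟨h.coprime, h.A_ne_zero, h.B_ne_zero, by rw [add_comm, h.add], by rw [mul_comm, h.mul]⟩

theorem C_ne_zero (h : HessianTriple d A B C C') : C ≠ 0 := by
  rintro rfl
  have := h.mul
  simp [h.A_ne_zero] at this

theorem natTrailingDegree_add (h : HessianTriple d A B C C') :
    C.natTrailingDegree + C'.natTrailingDegree = 3 * A.natTrailingDegree := by
  rw [← natTrailingDegree_mul h.C_ne_zero h.symm.C_ne_zero, h.mul, natTrailingDegree_neg,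
    natTrailingDegree_pow_three h.A_ne_zero]

theorem isCoprime_C_B (h : HessianTriple d A B C C') : IsCoprime C B := by
  have h1 : IsCoprime (C * C') B := by
    rw [h.mul]
    exact (h.coprime.pow_left (m := 3)).neg_left
  exact h1.of_mul_left_left

theorem not_X_dvd_B (h : HessianTriple d A B C C') (hC : C.natTrailingDegree ≠ 0) : ¬ X ∣ B := by
  intro hB
  have h1 : X ^ 1 ∣ C := (X_pow_dvd_iff_le_natTrailingDegree h.C_ne_zero).2 (by omega)
  rw [pow_one] at h1
  exact prime_X.not_isUnit (h.isCoprime_C_B.isUnit_of_dvd' h1 hB)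

theorem X_pow_dvd_of_le_nodeDepth (h : HessianTriple d A B C C') {n : ℕ}
    (hn : n ≤ nodeDepth C C') : X ^ n ∣ C :=
  (X_pow_dvd_iff_le_natTrailingDegree h.C_ne_zero).2 (hn.trans (min_le_left _ _))

theorem X_pow_dvd_A (h : HessianTriple d A B C C') {n : ℕ} (hn : n ≠ 0) (hd : n ≤ d)
    (hC : n ≤ C.natTrailingDegree) (hC' : n ≤ C'.natTrailingDegree) : X ^ n ∣ A := by
  have hAB : A * B = X ^ d * B ^ 3 - (C + C') := by linear_combination h.add
  refine prime_X.pow_dvd_of_dvd_mul_right n (h.not_X_dvd_B (by omega)) ?_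
  rw [hAB]
  exact dvd_sub ((pow_dvd_pow X hd).mul_right _) (dvd_add
    ((X_pow_dvd_iff_le_natTrailingDegree h.C_ne_zero).2 hC)
    ((X_pow_dvd_iff_le_natTrailingDegree h.symm.C_ne_zero).2 hC'))

/-- Away from the middle components, that is for depth strictly between `0` and `d`, the orders of
`C` and `C'` are in the ratio `2 : 1`. -/
theorem natTrailingDegree_of_lt (h : HessianTriple d A B C C')
    (h0 : C'.natTrailingDegree ≠ 0) (hle : C'.natTrailingDegree ≤ C.natTrailingDegree)
    (hd : C'.natTrailingDegree < d) : C.natTrailingDegree = 2 * C'.natTrailingDegree := by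
  have hv := h.natTrailingDegree_add
  have hA := h.A_ne_zero
  have h1 := (X_pow_dvd_iff_le_natTrailingDegree hA).1 (h.X_pow_dvd_A h0 hd.le hle le_rfl)
  rcases hle.lt_or_eq with hlt | heq
  · by_contra! hne
    have h2 : C'.natTrailingDegree + 1 ≤ A.natTrailingDegree := by omega
    have h3 : X ^ (C'.natTrailingDegree + 1) ∣ C' := by
      have e : C' = X ^ d * B ^ 3 - C - A * B := by linear_combination h.add
      have h3 := dvd_sub (dvd_sub ((pow_dvd_pow X hd).mul_right (B ^ 3))
        ((X_pow_dvd_iff_le_natTrailingDegree h.C_ne_zero).2 hlt))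
        (((X_pow_dvd_iff_le_natTrailingDegree hA).2 h2).mul_right B)
      rwa [← e] at h3
    have := (X_pow_dvd_iff_le_natTrailingDegree h.symm.C_ne_zero).1 h3
    omega
  · omega

theorem natTrailingDegree_add_X_pow {D : F[X]} (hC : C ≠ 0) (hlt : C.natTrailingDegree < d) :
    (C + X ^ d * D).natTrailingDegree = C.natTrailingDegree ∧ C + X ^ d * D ≠ 0 := by
  have h : ∀ n ≤ d, X ^ n ∣ C + X ^ d * D → n ≤ C.natTrailingDegree := fun n hn h1 =>
    (X_pow_dvd_iff_le_natTrailingDegree hC).1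
      ((dvd_add_left ((pow_dvd_pow X hn).mul_right _)).1 h1)
  have h0 : C + X ^ d * D ≠ 0 := by
    intro h0
    have := h d le_rfl (by rw [h0]; exact dvd_zero _)
    omega
  refine ⟨natTrailingDegree_eq_of_X_pow_dvd_sub hC h0 ?_, h0⟩
  rw [sub_add_cancel_left]
  exact ((pow_dvd_pow X hlt).mul_right _).neg_right

theorem natTrailingDegree_X_pow_add (hB : ¬ X ∣ B) (hlt : d < C.natTrailingDegree) :
    (C + X ^ d * B ^ 3).natTrailingDegree = d ∧ C + X ^ d * B ^ 3 ≠ 0 := by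
  have hC : C ≠ 0 := by rintro rfl; simp at hlt
  have hB0 : B ≠ 0 := by rintro rfl; exact hB (dvd_zero _)
  have hv : (X ^ d * B ^ 3).natTrailingDegree = d := by
    have : ¬ 1 ≤ (B ^ 3).natTrailingDegree := by
      rw [← X_pow_dvd_iff_le_natTrailingDegree (pow_ne_zero _ hB0), pow_one]
      exact fun h => hB (prime_X.dvd_of_dvd_pow h)
    rw [natTrailingDegree_mul (pow_ne_zero _ X_ne_zero) (pow_ne_zero _ hB0),
      natTrailingDegree_X_pow]
    omega
  have h0 : X ^ d * B ^ 3 ≠ 0 := mul_ne_zero (pow_ne_zero _ X_ne_zero) (pow_ne_zero _ hB0)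
  have hd : X ^ (d + 1) ∣ C := (X_pow_dvd_iff_le_natTrailingDegree hC).2 hlt
  have h1 : C + X ^ d * B ^ 3 ≠ 0 := by
    intro h1
    have h2 : X ^ (d + 1) ∣ X ^ d * B ^ 3 := (dvd_add_right hd).1 (h1 ▸ dvd_zero _)
    have := (X_pow_dvd_iff_le_natTrailingDegree h0).1 h2
    omega
  refine ⟨?_, h1⟩
  rw [natTrailingDegree_eq_of_X_pow_dvd_sub h0 h1, hv]
  rw [hv, sub_add_cancel_right]
  exact hd.neg_right

/-- The case `ord₀ C' ≤ ord₀ C` of `nodeDepth_double`. -/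
theorem nodeDepth_double_aux (h : HessianTriple d A B C C') (hd : 1 ≤ d)
    (hle : C'.natTrailingDegree ≤ C.natTrailingDegree) {C₂ C₂' : F[X]}
    (h₂ : C₂ ≠ 0) (h₂' : C₂' ≠ 0)
    (e : C₂ * (X ^ C'.natTrailingDegree) ^ 3 = -(C' * (C + X ^ d * B ^ 3) ^ 3))
    (e' : C₂' * (X ^ C'.natTrailingDegree) ^ 3 = C * (C' + X ^ d * B ^ 3) ^ 3) :
    nodeDepth C₂ C₂' ≤ 2 * C'.natTrailingDegree ∧
      nodeDepth C₂ C₂' + 2 * C'.natTrailingDegree ≤ 3 * d := by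
  have hC := h.C_ne_zero
  have hC' := h.symm.C_ne_zero
  have hv := h.natTrailingDegree_add
  have E : C + X ^ d * B ^ 3 ≠ 0 → C₂.natTrailingDegree + 3 * C'.natTrailingDegree =
      C'.natTrailingDegree + 3 * (C + X ^ d * B ^ 3).natTrailingDegree := by
    intro hg
    have := congrArg natTrailingDegree e
    rwa [natTrailingDegree_mul h₂ (by simp), natTrailingDegree_pow_three (by simp),
      natTrailingDegree_X_pow, natTrailingDegree_neg, natTrailingDegree_mul hC' (pow_ne_zero _ hg),
      natTrailingDegree_pow_three hg] at this
  have E' : C' + X ^ d * B ^ 3 ≠ 0 → C₂'.natTrailingDegree + 3 * C'.natTrailingDegree =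
      C.natTrailingDegree + 3 * (C' + X ^ d * B ^ 3).natTrailingDegree := by
    intro hg
    have := congrArg natTrailingDegree e'
    rwa [natTrailingDegree_mul h₂' (by simp), natTrailingDegree_pow_three (by simp),
      natTrailingDegree_X_pow,
      natTrailingDegree_mul hC (pow_ne_zero _ hg), natTrailingDegree_pow_three hg] at this
  have hn := min_le_left C₂.natTrailingDegree C₂'.natTrailingDegree
  have hn' := min_le_right C₂.natTrailingDegree C₂'.natTrailingDegree
  rw [← nodeDepth] at hn hn'
  by_cases h0 : C'.natTrailingDegree = 0
  -- Depth `0`: neither `C` nor `C'` vanishes at `0`, for otherwise `X ∣ A` and both would.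
  · have h1 : C.natTrailingDegree = 0 := by
      by_contra hne
      have hA : X ∣ A := by
        rw [← pow_one X, X_pow_dvd_iff_le_natTrailingDegree h.A_ne_zero]
        omega
      have hX1 : X ∣ C := by
        rw [← pow_one X, X_pow_dvd_iff_le_natTrailingDegree hC]
        omega
      have hX2 : X ^ 1 ∣ C' := by
        have e1 : C' = X ^ d * B ^ 3 - A * B - C := by linear_combination h.add
        rw [pow_one, e1]
        exact dvd_sub (dvd_sub ((dvd_pow_self X (by omega)).mul_right _) (hA.mul_right _)) hX1
      rw [X_pow_dvd_iff_le_natTrailingDegree hC'] at hX2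
      omega
    obtain ⟨g1, g2⟩ := natTrailingDegree_add_X_pow (D := B ^ 3) hC (show _ < d by omega)
    have := E g2
    omega
  · have hB := h.symm.not_X_dvd_B h0
    rcases lt_or_ge C'.natTrailingDegree d with hlt | hge
    -- Here `ord₀ C = 2 i`. The term from `C₂'` has order `2 i`; once `4 i > 3 d`, the term from
    -- `C₂` has order `3 d - 2 i`.
    · have h2 := h.natTrailingDegree_of_lt h0 hle hlt
      obtain ⟨g1, g2⟩ := natTrailingDegree_add_X_pow (D := B ^ 3) hC' hlt
      have := E' g2
      refine ⟨by omega, ?_⟩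
      by_cases hb : 4 * C'.natTrailingDegree ≤ 3 * d
      · omega
      · obtain ⟨g1, g2⟩ := natTrailingDegree_X_pow_add (C := C) hB (show d < _ by omega)
        have := E g2
        omega
    -- Here `ord₀ C > d`, so the term from `C₂` has order `3 d - 2 i`, which is at most `2 i`.
    · have h1 : d ≤ A.natTrailingDegree := by
        apply (X_pow_dvd_iff_le_natTrailingDegree h.A_ne_zero).1
        exact h.X_pow_dvd_A (by omega) le_rfl (by omega) hge
      obtain ⟨g1, g2⟩ := natTrailingDegree_X_pow_add (C := C) hB (show d < _ by omega)
      have := E g2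
      omega

theorem nodeDepth_comm (C C' : F[X]) : nodeDepth C C' = nodeDepth C' C := min_comm _ _

/-- Under doubling, the depth `i` becomes at most `2 i` and at most `3d - 2 i`. The polynomials `C₂`
and `C₂'` are the numerators of the double after cancelling `X ^ i` from the tangent slope. -/
theorem nodeDepth_double (h : HessianTriple d A B C C') (hd : 1 ≤ d) {C₂ C₂' : F[X]}
    (h₂ : C₂ ≠ 0) (h₂' : C₂' ≠ 0)
    (e : C₂ * (X ^ nodeDepth C C') ^ 3 = -(C' * (C + X ^ d * B ^ 3) ^ 3))
    (e' : C₂' * (X ^ nodeDepth C C') ^ 3 = C * (C' + X ^ d * B ^ 3) ^ 3) :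
    nodeDepth C₂ C₂' ≤ 2 * nodeDepth C C' ∧
      nodeDepth C₂ C₂' + 2 * nodeDepth C C' ≤ 3 * d := by
  rcases le_total C'.natTrailingDegree C.natTrailingDegree with hle | hle
  · rw [nodeDepth, min_eq_right hle] at e e'
    rw [nodeDepth.eq_1 C C', min_eq_right hle]
    exact h.nodeDepth_double_aux hd hle h₂ h₂' e e'
  · rw [nodeDepth, min_eq_left hle] at e e'
    rw [nodeDepth.eq_1 C C', min_eq_left hle]
    -- The opposite point has the roles of `C` and `C'` exchanged.
    have := h.symm.nodeDepth_double_aux hd hle (C₂ := -C₂') (C₂' := -C₂) (by simpa) (by simpa)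
      (by linear_combination -e') (by linear_combination -e)
    rw [nodeDepth_comm] at this
    simpa [nodeDepth] using this

/-! ### Cancellation in the tangent slope -/

theorem two_mul_nodeDepth_le (h : HessianTriple d A B C C') :
    2 * nodeDepth C C' ≤ 3 * A.natTrailingDegree := by
  rw [← h.natTrailingDegree_add, nodeDepth]
  omega

theorem X_pow_dvd_A_sq (h : HessianTriple d A B C C') {n : ℕ} (hn : n ≤ 2 * A.natTrailingDegree) :
    X ^ n ∣ A ^ 2 := by
  refine (pow_dvd_pow X hn).trans ?_
  rw [mul_comm, pow_mul]
  exact pow_dvd_pow_of_dvd ((X_pow_dvd_iff_le_natTrailingDegree h.A_ne_zero).2 le_rfl) 2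

/-- The numerator `3x² - y` and the denominator `y - y'` of the tangent slope share the factor
`X ^ i`, where `i` is the depth. -/
theorem exists_tangent (h : HessianTriple d A B C C') : ∃ n m : F[X],
    3 * A ^ 2 - C * B = X ^ nodeDepth C C' * n ∧ C - C' = X ^ nodeDepth C C' * m := by
  have hC := h.X_pow_dvd_of_le_nodeDepth le_rfl
  have hC' := h.symm.X_pow_dvd_of_le_nodeDepth (nodeDepth_comm C C').le
  have := h.two_mul_nodeDepth_le
  obtain ⟨n, hn⟩ := dvd_sub ((h.X_pow_dvd_A_sq (n := nodeDepth C C') (by omega)).mul_left 3)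
    (hC.mul_right B)
  obtain ⟨m, hm⟩ := dvd_sub hC hC'
  exact ⟨n, m, hn, hm⟩

/-- Nothing but `X ^ i` cancels in the tangent slope. A prime `π ≠ X` in the numerator and the
denominator would be a singular point of the reduction at `π`, and `π²` would divide the
discriminant; at `X` the depth accounts for everything. -/
theorem isCoprime_tangent (h : HessianTriple d A B C C') (hd : 1 ≤ d) (h3 : (3 : F) ≠ 0)
    (hsq : Squarefree (27 * X ^ d + 1 : F[X])) (hCC : C ≠ C') {n m : F[X]}
    (hn : 3 * A ^ 2 - C * B = X ^ nodeDepth C C' * n) (hm : C - C' = X ^ nodeDepth C C' * m) :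
    IsCoprime n m := by
  have h3' : IsUnit (3 : F[X]) := by
    have := (isUnit_iff_ne_zero.2 h3).map (Polynomial.C : F →+* F[X])
    rwa [map_ofNat] at this
  have hx := hessian_double_x A B C C' (X ^ d) h.add h.mul
  have hy := hessian_tangent_sq A B C C' (X ^ d) h.add h.mul
  refine isCoprime_of_irreducible_dvd ?_ ?_
  · rintro ⟨-, rfl⟩
    rw [mul_zero, sub_eq_zero] at hm
    exact hCC hm
  intro π hπ hπn hπm
  have hp : Prime π := hπ.prime
  have dn : X ^ nodeDepth C C' * π ∣ 3 * A ^ 2 - C * B := by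
    rw [hn]; exact mul_dvd_mul_left _ hπn
  have dm : X ^ nodeDepth C C' * π ∣ C - C' := by
    rw [hm]; exact mul_dvd_mul_left _ hπm
  have hπn' : π ∣ 3 * A ^ 2 - C * B := (dvd_mul_left _ _).trans dn
  have hπm' : π ∣ C - C' := (dvd_mul_left _ _).trans dm
  have hπB : ¬ π ∣ B := by
    intro hB
    have h1 : π ∣ 3 * A ^ 2 := (dvd_sub_left (hB.mul_left C)).1 hπn'
    have h2 : π ∣ A := hp.dvd_of_dvd_pow (h3'.dvd_mul_left.1 h1)
    exact hp.not_isUnit (h.coprime.isUnit_of_dvd' h2 hB)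
  have hΦ : π ^ 2 ∣ A * (A ^ 3 + X ^ d * A * B ^ 4 - 2 * (X ^ d) ^ 2 * B ^ 6) := by
    rw [← hx]
    have h2 := mul_dvd_mul hπn' hπm'
    rw [← pow_two] at h2
    refine dvd_sub (dvd_add (pow_dvd_pow_of_dvd hπn' 2) ?_)
      ((pow_dvd_pow_of_dvd hπm' 2).mul_left _)
    rw [mul_left_comm]
    exact h2.mul_left B
  have hΨ : π ^ 2 ∣ 4 * A ^ 3 + A ^ 2 * B ^ 2 - 2 * X ^ d * A * B ^ 4 + (X ^ d) ^ 2 * B ^ 6 := by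
    rw [← hy]
    exact pow_dvd_pow_of_dvd hπm' 2
  have hs : ∀ k, π ∣ (X ^ d) ^ 2 * B ^ k → π ∣ X := fun k hk =>
    hp.dvd_of_dvd_pow (hp.dvd_of_dvd_pow
      ((hp.dvd_or_dvd hk).resolve_right fun hB => hπB (hp.dvd_of_dvd_pow hB)))
  by_cases hπX : π ∣ X
  · have ha : Associated π X := hπ.associated_of_dvd prime_X.irreducible hπX
    have hXB : ¬ X ∣ B := fun hB => hπB (ha.dvd.trans hB)
    have dn : X ^ (nodeDepth C C' + 1) ∣ 3 * A ^ 2 - C * B :=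
      (mul_dvd_mul_left _ ha.symm.dvd).trans dn
    have dm : X ^ (nodeDepth C C' + 1) ∣ C - C' :=
      (mul_dvd_mul_left _ ha.symm.dvd).trans dm
    have hge := h.two_mul_nodeDepth_le
    have hA1 : nodeDepth C C' + 1 ≤ 2 * A.natTrailingDegree := by
      by_cases h0 : nodeDepth C C' = 0
      · have hXA : X ^ 1 ∣ A := by
          rw [pow_one]
          have e : A ^ 4 = A * (A ^ 3 + X ^ d * A * B ^ 4 - 2 * (X ^ d) ^ 2 * B ^ 6) -
            X ^ d * (A ^ 2 * B ^ 4 - 2 * X ^ d * A * B ^ 6) := by ring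
          refine prime_X.dvd_of_dvd_pow (n := 4) ?_
          rw [e]
          refine dvd_sub ?_ ((dvd_pow_self X (by omega)).mul_right _)
          exact ha.symm.dvd.trans ((dvd_pow_self π two_ne_zero).trans hΦ)
        have := (X_pow_dvd_iff_le_natTrailingDegree h.A_ne_zero).1 hXA
        omega
      · omega
    have hCB := (dvd_sub_right ((h.X_pow_dvd_A_sq hA1).mul_left 3)).1 dn
    have hC : X ^ (nodeDepth C C' + 1) ∣ C := prime_X.pow_dvd_of_dvd_mul_right _ hXB hCB
    have hC' := (dvd_sub_right hC).1 dm
    rw [X_pow_dvd_iff_le_natTrailingDegree h.C_ne_zero] at hC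
    rw [X_pow_dvd_iff_le_natTrailingDegree h.symm.C_ne_zero] at hC'
    rw [nodeDepth] at hC hC'
    omega
  · have hπA : ¬ π ∣ A := by
      intro hA
      have h1 : π ∣ (X ^ d) ^ 2 * B ^ 6 := by
        have e : (X ^ d) ^ 2 * B ^ 6 = 4 * A ^ 3 + A ^ 2 * B ^ 2 - 2 * X ^ d * A * B ^ 4 +
          (X ^ d) ^ 2 * B ^ 6 - A * (4 * A ^ 2 + A * B ^ 2 - 2 * X ^ d * B ^ 4) := by ring
        rw [e]
        exact dvd_sub ((dvd_pow_self π two_ne_zero).trans hΨ) (hA.mul_right _)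
      exact hπX (hs 6 h1)
    have hc := hp.pow_dvd_of_dvd_mul_left 2 hπA hΦ
    -- The squared denominator is `4 c + (x - 3 s)²` with `c` the cubic factor of `x(2P)`, so `π²`
    -- dividing both forces `x ≡ 3 s`, and `c(3 s) = s² (27 s + 1)`.
    have hw : π ∣ A - 3 * X ^ d * B ^ 2 := by
      have h1 : π ^ 2 ∣ B ^ 2 * (A - 3 * X ^ d * B ^ 2) ^ 2 := by
        have e : B ^ 2 * (A - 3 * X ^ d * B ^ 2) ^ 2 = 4 * A ^ 3 + A ^ 2 * B ^ 2 -
          2 * X ^ d * A * B ^ 4 + (X ^ d) ^ 2 * B ^ 6 -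
          4 * (A ^ 3 + X ^ d * A * B ^ 4 - 2 * (X ^ d) ^ 2 * B ^ 6) := by ring
        rw [e]
        exact dvd_sub hΨ (hc.mul_left 4)
      exact hp.dvd_of_dvd_pow ((hp.dvd_or_dvd ((dvd_pow_self π two_ne_zero).trans h1)).resolve_left
        fun hB => hπB (hp.dvd_of_dvd_pow hB))
    obtain ⟨w, hw⟩ := hw
    have hA : A = 3 * X ^ d * B ^ 2 + π * w := by linear_combination hw
    have e : A ^ 3 + X ^ d * A * B ^ 4 - 2 * (X ^ d) ^ 2 * B ^ 6 =
        (27 * X ^ d + 1) * (X ^ d * B ^ 4 * (X ^ d * B ^ 2 + π * w)) +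
          π ^ 2 * (9 * X ^ d * B ^ 2 * w ^ 2 + π * w ^ 3) := by
      rw [hA]; ring
    have h1 : π ^ 2 ∣ (27 * X ^ d + 1) * (X ^ d * B ^ 4 * (X ^ d * B ^ 2 + π * w)) := by
      rw [e] at hc
      exact (dvd_add_left (dvd_mul_right _ _)).1 hc
    have h2 : ¬ π ∣ X ^ d * B ^ 4 * (X ^ d * B ^ 2 + π * w) := by
      intro h2
      rcases hp.dvd_or_dvd h2 with h2 | h2
      · rcases hp.dvd_or_dvd h2 with h2 | h2
        · exact hπX (hp.dvd_of_dvd_pow h2)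
        · exact hπB (hp.dvd_of_dvd_pow h2)
      · rcases hp.dvd_or_dvd ((dvd_add_left (dvd_mul_right _ _)).1 h2) with h2 | h2
        · exact hπX (hp.dvd_of_dvd_pow h2)
        · exact hπB (hp.dvd_of_dvd_pow h2)
    have h4 := hp.pow_dvd_of_dvd_mul_right 2 h2 h1
    rw [pow_two] at h4
    exact hp.not_isUnit (hsq π h4)

end HessianTriple

/-! ### The naive height -/

/-- The naive height of the point with `x = A / B²`. Divided by `3`, it is
up to a constant the sum over all places of the local pole orders of `x`, where at infinity a model
with good reduction is used; that model exists over `F(t^{1/3})`, whence the fraction `2d / 3`. -/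
def naiveHeight {F : Type*} [Field F] (d : ℕ) (A B : F[X]) : ℕ :=
  max (3 * A.natDegree) (6 * B.natDegree + 2 * d)

section Height

variable {F : Type*} [Field F]

theorem natDegree_add_of_eq_of_lt {f g : F[X]} {n : ℕ} (hf : f.natDegree = n)
    (hg : g.natDegree < n) : (f + g).natDegree = n := by
  rw [natDegree_add_eq_left_of_natDegree_lt (by omega), hf]

/-- The duplication formula `x(2P) = Φ / (B M)²`, before any cancellation at finite places, has at
least four times the height: the leading terms of `Φ` and `M²` do not cancel both. -/
theorem four_mul_naiveHeight_le {d : ℕ} {A B M : F[X]} (h3 : (3 : F) ≠ 0)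
    (hd : 1 ≤ d) (hB : B ≠ 0)
    (hM : M ^ 2 = 4 * A ^ 3 + A ^ 2 * B ^ 2 - 2 * X ^ d * A * B ^ 4 + (X ^ d) ^ 2 * B ^ 6) :
    4 * naiveHeight d A B ≤ naiveHeight d
      (A * (A ^ 3 + X ^ d * A * B ^ 4 - 2 * (X ^ d) ^ 2 * B ^ 6)) (B * M) := by
  -- Every monomial is written as `k * (X ^ d) ^ i * A ^ j * B ^ l` to bound its degree uniformly.
  have hmono : ∀ (k i j l : ℕ), ((k : F[X]) * (X ^ d) ^ i * A ^ j * B ^ l).natDegree ≤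
      i * d + j * A.natDegree + l * B.natDegree := by
    intro k i j l
    have h1 : ((k : F[X]) * (X ^ d) ^ i * A ^ j * B ^ l).natDegree ≤
      0 + i * d + j * A.natDegree + l * B.natDegree := by
      refine natDegree_mul_le_of_le (natDegree_mul_le_of_le (natDegree_mul_le_of_le ?_ ?_) ?_) ?_
      · simp
      · rw [← pow_mul, natDegree_X_pow, mul_comm]
      · simp
      · simp
    simpa using h1
  have hΦ : A * (A ^ 3 + X ^ d * A * B ^ 4 - 2 * (X ^ d) ^ 2 * B ^ 6) =
      A ^ 4 + (((1 : ℕ) : F[X]) * (X ^ d) ^ 1 * A ^ 2 * B ^ 4 -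
        ((2 : ℕ) : F[X]) * (X ^ d) ^ 2 * A ^ 1 * B ^ 6) := by
    push_cast; ring
  have hM2 : (M ^ 2).natDegree = 2 * M.natDegree := natDegree_pow _ _
  have hA4 : (A ^ 4).natDegree = 4 * A.natDegree := natDegree_pow _ _
  have m1 := hmono 1 1 2 4
  have m2 := hmono 2 2 1 6
  rcases lt_trichotomy (6 * B.natDegree + 2 * d) (3 * A.natDegree) with hlt | heq | hgt
  · have : (A * (A ^ 3 + X ^ d * A * B ^ 4 - 2 * (X ^ d) ^ 2 * B ^ 6)).natDegree =
        4 * A.natDegree := by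
      rw [hΦ]
      refine natDegree_add_of_eq_of_lt hA4 ?_
      refine (natDegree_sub_le _ _).trans_lt (max_lt ?_ ?_) <;> omega
    rw [naiveHeight, naiveHeight, this]
    omega
  -- The leading terms of `Φ` and `M²` balance: `Φ + 2 A M²` has the leading term of `9 A⁴`.
  · have e : A ^ 4 * 9 = A * (A ^ 3 + X ^ d * A * B ^ 4 - 2 * (X ^ d) ^ 2 * B ^ 6) +
        ((2 : F[X]) * A * M ^ 2 -
          (((2 : ℕ) : F[X]) * (X ^ d) ^ 0 * A ^ 3 * B ^ 2 -
            ((3 : ℕ) : F[X]) * (X ^ d) ^ 1 * A ^ 2 * B ^ 4)) := by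
      rw [hM]; push_cast; ring
    have h9 : (A ^ 4 * 9).natDegree = 4 * A.natDegree := by
      have : (9 : F) ≠ 0 := by
        have e9 : (9 : F) = 3 * 3 := by norm_num
        rw [e9]
        exact mul_ne_zero h3 h3
      rw [← map_ofNat (Polynomial.C : F →+* F[X]) 9, natDegree_mul_C this, hA4]
    have m3 := hmono 2 0 3 2
    have m4 := hmono 3 1 2 4
    by_contra! hlt
    rw [naiveHeight, naiveHeight, max_lt_iff] at hlt
    obtain ⟨l1, l2⟩ := hlt
    have hAM : ((2 : F[X]) * A * M ^ 2).natDegree < 4 * A.natDegree := by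
      by_cases hM0 : M = 0
      · simp [hM0]
        omega
      · rw [natDegree_mul hB hM0] at l2
        refine (natDegree_mul_le_of_le (m := A.natDegree) (natDegree_mul_le.trans (by simp))
          le_rfl).trans_lt ?_
        omega
    rw [e] at h9
    refine h9.not_lt ((natDegree_add_le _ _).trans_lt (max_lt (by omega) ?_))
    refine (natDegree_sub_le _ _).trans_lt (max_lt hAM ?_)
    refine (natDegree_sub_le _ _).trans_lt (max_lt ?_ ?_) <;> omega
  · have e : M ^ 2 = (X ^ d) ^ 2 * B ^ 6 + (((4 : ℕ) : F[X]) * (X ^ d) ^ 0 * A ^ 3 * B ^ 0 +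
        (((1 : ℕ) : F[X]) * (X ^ d) ^ 0 * A ^ 2 * B ^ 2 -
          ((2 : ℕ) : F[X]) * (X ^ d) ^ 1 * A ^ 1 * B ^ 4)) := by
      rw [hM]; push_cast; ring
    have m3 := hmono 4 0 3 0
    have m4 := hmono 1 0 2 2
    have m5 := hmono 2 1 1 4
    have hl : ((X ^ d) ^ 2 * B ^ 6).natDegree = 2 * d + 6 * B.natDegree := by
      rw [natDegree_mul (by simp) (by simp [hB]), ← pow_mul, natDegree_X_pow, natDegree_pow,
        mul_comm]
    have : (M ^ 2).natDegree = 2 * d + 6 * B.natDegree := by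
      rw [e]
      refine natDegree_add_of_eq_of_lt hl ?_
      refine (natDegree_add_le _ _).trans_lt (max_lt (by omega) ?_)
      refine (natDegree_sub_le _ _).trans_lt (max_lt ?_ ?_) <;> omega
    have hM0 : M ≠ 0 := by
      rintro rfl
      simp at this
      omega
    rw [naiveHeight, naiveHeight, natDegree_mul hB hM0]
    omega

end Height

/-! ### Doubling a point in lowest terms -/

namespace HessianTriple

variable {F : Type*} [Field F] {d : ℕ} {A B C C' : F[X]}

/-- There is no point of order two. If `y = y'` then `x = -w²` and `y = -w³` with
`w² (2 w + 1) = -s` up to units, and a power of the prime `X` with positive exponent has no such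
factorization. -/
theorem ne (h : HessianTriple d A B C C') (hd : 1 ≤ d) (h2 : (2 : F) ≠ 0) : C ≠ C' := by
  rintro rfl
  have hX : Prime (X : F[X]) := prime_X
  obtain ⟨W, hW⟩ : A ∣ C := by
    rw [← UniqueFactorizationMonoid.pow_dvd_pow_iff_dvd two_ne_zero, pow_two C, h.mul]
    exact ((pow_dvd_pow A (by norm_num)).neg_right)
  have hA := h.A_ne_zero
  have hAW : A = -W ^ 2 := by
    apply mul_left_cancel₀ (pow_ne_zero 2 hA)
    have := h.mul
    rw [hW] at this
    linear_combination this
  have hCW : C = -W ^ 3 := by rw [hW, hAW]; ring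
  have hW0 : W ≠ 0 := by
    rintro rfl
    simp [hA] at hAW
  have hBu : IsUnit B := by
    have h2' : IsUnit (2 : F[X]) := by
      have := (isUnit_iff_ne_zero.2 h2).map (Polynomial.C : F →+* F[X])
      rwa [map_ofNat] at this
    have h1 : B ∣ 2 * C := ⟨X ^ d * B ^ 2 - A, by linear_combination h.add⟩
    exact h.isCoprime_C_B.isUnit_of_dvd' (h2'.dvd_mul_left.1 h1) dvd_rfl
  have e : W ^ 2 * (2 * W + B) = -(X ^ d * B ^ 3) := by
    have := h.add
    rw [hCW, hAW] at this
    linear_combination -this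
  have hB0 := natDegree_eq_zero_of_isUnit hBu
  have hne : 2 * W + B ≠ 0 := by
    intro h0
    rw [h0, mul_zero, eq_comm, neg_eq_zero] at e
    exact mul_ne_zero (pow_ne_zero _ X_ne_zero) (pow_ne_zero _ h.B_ne_zero) e
  have hdeg : 2 * W.natDegree + (2 * W + B).natDegree = d := by
    have := congrArg natDegree e
    rwa [natDegree_mul (pow_ne_zero _ hW0) hne, natDegree_pow, natDegree_neg,
      natDegree_mul (by simp) (by simp [h.B_ne_zero]), natDegree_X_pow, natDegree_pow, hB0,
      mul_zero, add_zero] at this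
  have hle : (2 * W + B).natDegree ≤ W.natDegree := by
    refine (natDegree_add_le _ _).trans (max_le ?_ (by omega))
    exact (natDegree_mul_le).trans (by simp)
  have hle' : W.natDegree ≤ (2 * W + B).natDegree := by
    have h4 : (2 * W).natDegree = W.natDegree := by
      rw [← map_ofNat (Polynomial.C : F →+* F[X]) 2, natDegree_C_mul h2]
    have h5 : 2 * W = (2 * W + B) - B := by ring
    have h6 := natDegree_sub_le (2 * W + B) B
    rw [← h5, h4] at h6
    exact h6.trans (max_le le_rfl (by omega))
  have hdvd : X ^ d ∣ W ^ 2 * (2 * W + B) := by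
    rw [e]
    exact (dvd_mul_right _ _).neg_right
  by_cases hXW : X ∣ W
  · have : ¬ X ∣ 2 * W + B := fun h6 =>
      hX.not_isUnit (isUnit_of_dvd_unit ((dvd_add_right (hXW.mul_left 2)).1 h6) hBu)
    have := natDegree_le_of_dvd (hX.pow_dvd_of_dvd_mul_right _ this hdvd) (pow_ne_zero 2 hW0)
    rw [natDegree_X_pow, natDegree_pow] at this
    omega
  · have := natDegree_le_of_dvd (hX.pow_dvd_of_dvd_mul_left _
      (fun h6 => hXW (hX.dvd_of_dvd_pow h6)) hdvd) hne
    rw [natDegree_X_pow] at this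
    omega

/-- The double of a point in lowest terms is again in lowest terms, after cancelling `X ^ i` from
the tangent slope `n / (B m)`. -/
theorem exists_double (h : HessianTriple d A B C C') (hd : 1 ≤ d) (h2 : (2 : F) ≠ 0)
    (h3 : (3 : F) ≠ 0) (hsq : Squarefree (27 * X ^ d + 1 : F[X]))
    (hx : A ^ 3 + X ^ d * A * B ^ 4 - 2 * (X ^ d) ^ 2 * B ^ 6 ≠ 0) :
    ∃ A₂ B₂ C₂ C₂' n m : F[X], HessianTriple d A₂ B₂ C₂ C₂' ∧
      3 * A ^ 2 - C * B = X ^ nodeDepth C C' * n ∧ C - C' = X ^ nodeDepth C C' * m ∧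
      B₂ = B * m ∧ A₂ = n ^ 2 + n * B₂ - 2 * A * m ^ 2 ∧
      C₂' = n * (A₂ - A * m ^ 2) + C * m ^ 3 ∧
      nodeDepth C₂ C₂' ≤ 2 * nodeDepth C C' ∧
      nodeDepth C₂ C₂' + 2 * nodeDepth C C' ≤ 3 * d ∧
      4 * naiveHeight d A B ≤ naiveHeight d A₂ B₂ + 6 * nodeDepth C C' := by
  obtain ⟨n, m, hn, hm⟩ := h.exists_tangent
  have hcop := h.isCoprime_tangent hd h3 hsq (h.ne hd h2) hn hm
  have hX := hessian_double_x A B C C' (X ^ d) h.add h.mul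
  have hY := hessian_double_negY A B C C' (X ^ d) h.add h.mul
  have hM := hessian_tangent_sq A B C C' (X ^ d) h.add h.mul
  have hm0 : m ≠ 0 := by
    rintro rfl
    rw [mul_zero, sub_eq_zero] at hm
    exact h.ne hd h2 hm
  have hB := h.B_ne_zero
  have hA := h.A_ne_zero
  set e : F[X] := X ^ nodeDepth C C' with he
  have he0 : e ≠ 0 := pow_ne_zero _ X_ne_zero
  obtain ⟨A₂, hA₂⟩ : ∃ A₂, A₂ = n ^ 2 + n * (B * m) - 2 * A * m ^ 2 := ⟨_, rfl⟩
  obtain ⟨C₂', hC₂'⟩ : ∃ C₂', C₂' = n * (A₂ - A * m ^ 2) + C * m ^ 3 := ⟨_, rfl⟩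
  obtain ⟨C₂, hC₂⟩ : ∃ C₂, C₂ = X ^ d * (B * m) ^ 3 - A₂ * (B * m) - C₂' := ⟨_, rfl⟩
  have eA : A₂ * e ^ 2 = A * (A ^ 3 + X ^ d * A * B ^ 4 - 2 * (X ^ d) ^ 2 * B ^ 6) := by
    rw [← hX, hn, hm, hA₂]; ring
  have eC' : C₂' * e ^ 3 = C * (C' + X ^ d * B ^ 3) ^ 3 := by
    rw [← hY, ← eA, hn, hm, hC₂']; ring
  have eC : C₂ * e ^ 3 = -(C' * (C + X ^ d * B ^ 3) ^ 3) := by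
    have e1 : C₂ * e ^ 3 = X ^ d * B ^ 3 * (C - C') ^ 3 - A₂ * e ^ 2 * (B * (C - C')) -
        C₂' * e ^ 3 := by
      rw [hC₂, hm]; ring
    rw [e1, eA, eC', hessian_double_y A B C C' (X ^ d) h.add h.mul]
  have hA₂0 : A₂ ≠ 0 := by
    rintro rfl
    rw [zero_mul, eq_comm] at eA
    exact mul_ne_zero hA hx eA
  have hmul : C₂ * C₂' = -A₂ ^ 3 := by
    apply mul_right_cancel₀ (pow_ne_zero 6 he0)
    have e1 : C₂ * C₂' * e ^ 6 = (C₂ * e ^ 3) * (C₂' * e ^ 3) := by ring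
    have e2 : -A₂ ^ 3 * e ^ 6 = -(A₂ * e ^ 2) ^ 3 := by ring
    have h5 : (C + X ^ d * B ^ 3) * (C' + X ^ d * B ^ 3) =
      - (A ^ 3 + X ^ d * A * B ^ 4 - 2 * (X ^ d) ^ 2 * B ^ 6) := by
      linear_combination h.mul + X ^ d * B ^ 3 * h.add
    rw [e1, e2, eA, eC, eC', mul_pow A, ← neg_eq_iff_eq_neg.2 h5]
    linear_combination (-((C + X ^ d * B ^ 3) * (C' + X ^ d * B ^ 3)) ^ 3) * h.mul
  have hT : HessianTriple d A₂ (B * m) C₂ C₂' := by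
    refine ⟨?_, hA₂0, mul_ne_zero hB hm0, by rw [hC₂]; ring, hmul⟩
    refine IsCoprime.mul_right ?_ ?_
    -- Modulo `B` the numerator of `x(2P)` is `A⁴`, and modulo `m` it is `n²`.
    · have h7 := (h.coprime.pow_left (m := 4)).add_mul_right_left
        (X ^ d * A ^ 2 * B ^ 3 - 2 * (X ^ d) ^ 2 * A * B ^ 5)
      have h8 : A ^ 4 + (X ^ d * A ^ 2 * B ^ 3 - 2 * (X ^ d) ^ 2 * A * B ^ 5) * B = A₂ * e ^ 2 := by
        rw [eA]; ring
      rw [h8] at h7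
      exact h7.of_mul_left_left
    · have := (hcop.pow_left (m := 2)).add_mul_right_left (n * B - 2 * A * m)
      have h9 : n ^ 2 + (n * B - 2 * A * m) * m = A₂ := by
        rw [hA₂]; ring
      rwa [h9] at this
  refine ⟨A₂, B * m, C₂, C₂', n, m, hT, hn, hm, rfl, hA₂, hC₂', ?_⟩
  obtain ⟨d1, d2⟩ := h.nodeDepth_double hd hT.C_ne_zero hT.symm.C_ne_zero eC eC'
  refine ⟨d1, d2, ?_⟩
  have h4 := four_mul_naiveHeight_le h3 hd hB hM
  rw [← eA, hm] at h4
  refine h4.trans ?_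
  rw [naiveHeight, naiveHeight, natDegree_mul hA₂0 (pow_ne_zero _ he0), natDegree_pow,
    mul_left_comm, natDegree_mul he0 (mul_ne_zero hB hm0), he, natDegree_X_pow]
  omega

end HessianTriple

/-! ### Coordinates in lowest terms -/

section LowestTerms

variable {F : Type*} [Field F] {d : ℕ}

local notation "ι" => algebraMap (Polynomial F) (RatFunc F)

/-- The denominators of `x` and `y` are the square and the cube of one polynomial, up to units.
With `x = a / b` and `y = c / e` reduced, the cleared equation shows that `e = b f` and `b = f g`,
and that `f` and `g` are associated. -/
theorem exists_hessianTriple {x y : RatFunc F}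
    (h : y ^ 2 + x * y - RatFunc.X ^ d * y = x ^ 3) (hx : x ≠ 0) :
    ∃ A B C C' : F[X], HessianTriple d A B C C' ∧ x * ι B ^ 2 = ι A ∧ y * ι B ^ 3 = ι C := by
  have hinj : Function.Injective ι := RatFunc.algebraMap_injective F
  set a := x.num
  set b := x.denom
  set c := y.num
  set e := y.denom
  have hb : b ≠ 0 := x.denom_ne_zero
  have he : e ≠ 0 := y.denom_ne_zero
  have hb' : ι b ≠ 0 := RatFunc.algebraMap_ne_zero hb
  have he' : ι e ≠ 0 := RatFunc.algebraMap_ne_zero he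
  have hab : IsCoprime a b := x.isCoprime_num_denom
  have hce : IsCoprime c e := y.isCoprime_num_denom
  have hxb : x * ι b = ι a := by
    rw [← eq_div_iff hb']; exact (RatFunc.num_div_denom x).symm
  have hye : y * ι e = ι c := by
    rw [← eq_div_iff he']; exact (RatFunc.num_div_denom y).symm
  have key : c ^ 2 * b ^ 3 + a * c * e * b ^ 2 - X ^ d * c * e * b ^ 3 = a ^ 3 * e ^ 2 := by
    apply hinj
    simp only [map_add, map_sub, map_mul, map_pow, RatFunc.algebraMap_X, ← hxb, ← hye]
    linear_combination (ι e ^ 2 * ι b ^ 3) * h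
  have hbe : b ∣ e := by
    have h1 : b ^ 2 ∣ a ^ 3 * e ^ 2 :=
      ⟨c ^ 2 * b + a * c * e - X ^ d * c * e * b, by rw [← key]; ring⟩
    exact (UniqueFactorizationMonoid.pow_dvd_pow_iff_dvd two_ne_zero).1
      ((hab.symm.pow (m := 2) (n := 3)).dvd_of_dvd_mul_left h1)
  obtain ⟨f, hf⟩ := hbe
  have hf0 : f ≠ 0 := by rintro rfl; simp [hf] at he
  have key2 : c ^ 2 * b + a * c * b * f - X ^ d * c * b ^ 2 * f = a ^ 3 * f ^ 2 := by
    apply mul_left_cancel₀ (pow_ne_zero 2 hb)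
    rw [hf] at key
    linear_combination key
  have hcf : IsCoprime c f := by
    rw [hf] at hce
    exact hce.of_mul_right_right
  have hfb : f ∣ b := by
    have h1 : f ∣ c ^ 2 * b :=
      ⟨a ^ 3 * f - a * c * b + X ^ d * c * b ^ 2, by linear_combination key2⟩
    exact (hcf.symm.pow_right (n := 2)).dvd_of_dvd_mul_left h1
  have hbf : b ∣ f ^ 2 := by
    have h1 : b ∣ a ^ 3 * f ^ 2 :=
      ⟨c ^ 2 + a * c * f - X ^ d * c * b * f, by rw [← key2]; ring⟩
    exact (hab.symm.pow_right (n := 3)).dvd_of_dvd_mul_left h1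
  obtain ⟨g, hg⟩ := hfb
  have hgf : g ∣ f := by
    rw [hg, pow_two] at hbf
    exact (mul_dvd_mul_iff_left hf0).1 hbf
  have key3 : c ^ 2 * g + a * c * g * f - X ^ d * c * g ^ 2 * f ^ 2 = a ^ 3 * f := by
    apply mul_left_cancel₀ hf0
    rw [hg] at key2
    linear_combination key2
  have hfg : f ∣ g := by
    have h1 : f ∣ c ^ 2 * g :=
      ⟨a ^ 3 - a * c * g + X ^ d * c * g ^ 2 * f, by linear_combination key3⟩
    exact (hcf.symm.pow_right (n := 2)).dvd_of_dvd_mul_left h1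
  obtain ⟨u, hu⟩ := associated_of_dvd_dvd hfg hgf
  have hb2 : b = f ^ 2 * u := by rw [hg, ← hu]; ring
  have he3 : e = f ^ 3 * u := by rw [hf, hb2]; ring
  have huu : (u : F[X]) * (↑u⁻¹ : F[X]) = 1 := u.mul_inv
  have huu' : ι (u : F[X]) * ι (↑u⁻¹ : F[X]) = 1 := by rw [← map_mul, huu, map_one]
  have hxA : x * ι f ^ 2 = ι (a * ↑u⁻¹) := by
    rw [map_mul, ← hxb, hb2, map_mul, map_pow]
    linear_combination -(x * ι f ^ 2) * huu'
  have hyC : y * ι f ^ 3 = ι (c * ↑u⁻¹) := by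
    rw [map_mul, ← hye, he3, map_mul, map_pow]
    linear_combination -(y * ι f ^ 3) * huu'
  refine ⟨a * ↑u⁻¹, f, c * ↑u⁻¹, X ^ d * f ^ 3 - a * (↑u⁻¹ : F[X]) * f - c * (↑u⁻¹ : F[X]),
    ⟨?_, ?_, hf0, by ring, ?_⟩, hxA, hyC⟩
  · refine (isCoprime_mul_unit_right_left u⁻¹.isUnit _ _).2 ?_
    rw [hg] at hab
    exact hab.of_mul_right_left
  · exact mul_ne_zero (RatFunc.num_ne_zero hx) u⁻¹.ne_zero
  · apply hinj
    simp only [map_sub, map_neg, map_pow, map_mul _ (X ^ d), map_mul _ (_ * _) f, map_mul _ (c * _),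
      RatFunc.algebraMap_X, ← hxA, ← hyC]
    linear_combination -(ι f ^ 6) * h

/-- The naive height `naiveHeight` in terms of the reduced fraction `x`, which shows that it
depends on the point alone. -/
noncomputable def ratFuncHeight (d : ℕ) (x : RatFunc F) : ℕ :=
  max (3 * x.num.natDegree) (3 * x.denom.natDegree + 2 * d)

theorem HessianTriple.ratFuncHeight_eq {A B C C' : F[X]} (h : HessianTriple d A B C C')
    {x : RatFunc F} (hx : x * ι B ^ 2 = ι A) : ratFuncHeight d x = naiveHeight d A B := by
  have hB : ι B ≠ 0 := RatFunc.algebraMap_ne_zero h.B_ne_zero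
  have hB2 : B ^ 2 ≠ 0 := pow_ne_zero 2 h.B_ne_zero
  have e : x = ι A / ι (B ^ 2) := by rw [map_pow, eq_div_iff (pow_ne_zero 2 hB), hx]
  have e1 : x.num * B ^ 2 = A * x.denom := by rw [RatFunc.num_mul_eq_mul_denom_iff hB2, e]
  have hc : IsCoprime A (B ^ 2) := h.coprime.pow_right
  have hc' := x.isCoprime_num_denom
  have a1 : Associated x.num A := associated_of_dvd_dvd
    (hc'.dvd_of_dvd_mul_right (Dvd.intro _ e1)) (hc.dvd_of_dvd_mul_right (Dvd.intro _ e1.symm))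
  have a2 : Associated x.denom (B ^ 2) := associated_of_dvd_dvd
    (hc'.symm.dvd_of_dvd_mul_left (Dvd.intro_left _ e1.symm))
    (hc.symm.dvd_of_dvd_mul_left (Dvd.intro_left _ e1))
  have d1 := natDegree_eq_of_degree_eq (degree_eq_degree_of_associated a1)
  have d2 := natDegree_eq_of_degree_eq (degree_eq_degree_of_associated a2)
  rw [natDegree_pow] at d2
  rw [ratFuncHeight, naiveHeight, d1, d2]
  congr 1
  ring

end LowestTerms

/-! ### The group law -/

section Points

open WeierstrassCurve.Affine

variable {F : Type*} [Field F] {d : ℕ}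

local notation "ι" => algebraMap (Polynomial F) (RatFunc F)

theorem hessianCurve_equation_iff {x y : RatFunc F} :
    (hessianCurve F d).toAffine.Equation x y ↔ y ^ 2 + x * y - RatFunc.X ^ d * y = x ^ 3 := by
  rw [WeierstrassCurve.Affine.equation_iff]
  simp [hessianCurve, sub_eq_add_neg]

theorem hessianCurve_negY (x y : RatFunc F) :
    (hessianCurve F d).toAffine.negY x y = RatFunc.X ^ d - x - y := by
  simp only [WeierstrassCurve.Affine.negY, hessianCurve]
  ring

theorem HessianTriple.tangent_ne_zero {A B C C' : F[X]} (hT : HessianTriple d A B C C')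
    (hd : 1 ≤ d) (h2 : (2 : F) ≠ 0)
    {x y : RatFunc F} (hx : x * ι B ^ 2 = ι A) (hy : y * ι B ^ 3 = ι C) :
    (2 * y + x - RatFunc.X ^ d) * ι B ^ 3 = ι (C - C') ∧ 2 * y + x - RatFunc.X ^ d ≠ 0 := by
  have h1 : (2 * y + x - RatFunc.X ^ d) * ι B ^ 3 = ι (C - C') := by
    have e : C - C' = 2 * C + A * B - X ^ d * B ^ 3 := by linear_combination -hT.add
    rw [e]
    simp only [map_add, map_sub, map_mul, map_pow, map_ofNat, RatFunc.algebraMap_X, ← hx, ← hy]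
    ring
  refine ⟨h1, fun h0 => ?_⟩
  rw [h0, zero_mul, eq_comm] at h1
  exact hT.ne hd h2 (sub_eq_zero.1 ((map_eq_zero_iff _ (RatFunc.algebraMap_injective F)).1 h1))

/-- `A`, `B`, `C`, `C'` describe the point `Q` in lowest terms. -/
def IsHessianTripleOf (Q : (hessianCurve F d).toAffine.Point) (A B C C' : F[X]) : Prop :=
  HessianTriple d A B C C' ∧ ∃ (x y : RatFunc F) (h : (hessianCurve F d).toAffine.Nonsingular x y),
    Q = .some x y h ∧ x * ι B ^ 2 = ι A ∧ y * ι B ^ 3 = ι C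

variable [DecidableEq (RatFunc F)]

/-- The duplication formula in terms of the tangent slope `l`. -/
theorem hessianCurve_add_self {x y : RatFunc F}
    (h : (hessianCurve F d).toAffine.Nonsingular x y) (hy : 2 * y + x - RatFunc.X ^ d ≠ 0) :
    ∃ (x₂ y₂ : RatFunc F) (h₂ : (hessianCurve F d).toAffine.Nonsingular x₂ y₂) (l : RatFunc F),
      Point.some x y h + Point.some x y h = Point.some x₂ y₂ h₂ ∧
      l * (2 * y + x - RatFunc.X ^ d) = 3 * x ^ 2 - y ∧ x₂ = l ^ 2 + l - 2 * x ∧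
      y₂ = RatFunc.X ^ d - x₂ - (l * (x₂ - x) + y) := by
  have hy' : y ≠ (hessianCurve F d).toAffine.negY x y := by
    rw [hessianCurve_negY]
    intro h0
    exact hy (by linear_combination h0)
  refine ⟨_, _, _, (hessianCurve F d).toAffine.slope x x y y,
    Point.add_self_of_Y_ne hy', ?_, ?_, ?_⟩
  · rw [WeierstrassCurve.Affine.slope_of_Y_ne rfl hy', hessianCurve_negY]
    have e : 2 * y + x - RatFunc.X ^ d = y - (RatFunc.X ^ d - x - y) := by ring
    rw [e] at hy ⊢
    rw [div_mul_cancel₀ _ hy]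
    simp [hessianCurve]
  · simp only [WeierstrassCurve.Affine.addX, hessianCurve]
    ring
  · rw [WeierstrassCurve.Affine.addY, hessianCurve_negY, WeierstrassCurve.Affine.negAddY]

theorem hessianPoint_add_self :
    hessianPoint F d + hessianPoint F d = -hessianPoint F d := by
  have hX : (RatFunc.X : RatFunc F) ^ d ≠ 0 := pow_ne_zero _ RatFunc.X_ne_zero
  obtain ⟨x₂, y₂, h₂, l, h1, h2, h3, h4⟩ := hessianCurve_add_self
    (hessianCurve_nonsingular_zero F d) (by simpa using hX)
  have hl : l = 0 := by
    have : l * RatFunc.X ^ d = 0 := by linear_combination -h2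
    exact (mul_eq_zero.1 this).resolve_right hX
  subst hl
  rw [hessianPoint, h1, Point.neg_some, Point.some.injEq, hessianCurve_negY]
  have : x₂ = 0 := by rw [h3]; ring
  refine ⟨this, ?_⟩
  rw [h4, this]
  ring

theorem addOrderOf_hessianPoint : addOrderOf (hessianPoint F d) = 3 := by
  have := Fact.mk Nat.prime_three
  refine addOrderOf_eq_prime ?_ (Point.some_ne_zero _)
  rw [succ_nsmul, two_nsmul, hessianPoint_add_self, neg_add_cancel]

theorem some_mem_zmultiples_of_x_eq_zero {y : RatFunc F}
    (h : (hessianCurve F d).toAffine.Nonsingular 0 y) :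
    Point.some 0 y h ∈ AddSubgroup.zmultiples (hessianPoint F d) := by
  have e := hessianCurve_equation_iff.1 h.1
  have : y * (y - RatFunc.X ^ d) = 0 := by linear_combination e
  rcases mul_eq_zero.1 this with rfl | h1
  · exact AddSubgroup.mem_zmultiples _
  · have h2 : Point.some 0 y h = -hessianPoint F d := by
      rw [hessianPoint, Point.neg_some, Point.some.injEq, hessianCurve_negY]
      exact ⟨rfl, by linear_combination h1⟩
    rw [h2]
    exact neg_mem (AddSubgroup.mem_zmultiples _)

theorem exists_isHessianTripleOf {Q : (hessianCurve F d).toAffine.Point}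
    (hQ : Q ∉ AddSubgroup.zmultiples (hessianPoint F d)) :
    ∃ A B C C' : F[X], IsHessianTripleOf Q A B C C' := by
  rcases Q with _ | ⟨x, y, h⟩
  · exact absurd (zero_mem _) hQ
  · have hx : x ≠ 0 := by
      rintro rfl
      exact hQ (some_mem_zmultiples_of_x_eq_zero h)
    obtain ⟨A, B, C, C', hT, h1, h2⟩ :=
      exists_hessianTriple (hessianCurve_equation_iff.1 h.1) hx
    exact ⟨A, B, C, C', hT, x, y, h, rfl, h1, h2⟩

theorem eq_zero_of_add_self_eq_zero (hd : 1 ≤ d) (h2 : (2 : F) ≠ 0)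
    {Q : (hessianCurve F d).toAffine.Point} (hQ : Q + Q = 0) : Q = 0 := by
  by_cases hm : Q ∈ AddSubgroup.zmultiples (hessianPoint F d)
  · obtain ⟨k, rfl⟩ := AddSubgroup.mem_zmultiples_iff.1 hm
    have h3 : (3 : ℕ) • (k • hessianPoint F d) = 0 := by
      rw [smul_comm, ← addOrderOf_hessianPoint (F := F) (d := d), addOrderOf_nsmul_eq_zero,
        smul_zero]
    rwa [succ_nsmul, two_nsmul, hQ, zero_add] at h3
  · obtain ⟨A, B, C, C', hT, x, y, h, rfl, hx, hy⟩ := exists_isHessianTripleOf hm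
    obtain ⟨x₂, y₂, h₂, l, e, -⟩ := hessianCurve_add_self h (hT.tangent_ne_zero hd h2 hx hy).2
    exact absurd (e.symm.trans hQ) (Point.some_ne_zero _)

/-- The subgroup `⟨P₀⟩` is uniquely divisible by two and there is no point of order two, so doubling
preserves its complement. -/
theorem add_self_notMem_zmultiples (hd : 1 ≤ d) (h2 : (2 : F) ≠ 0)
    {Q : (hessianCurve F d).toAffine.Point}
    (hQ : Q ∉ AddSubgroup.zmultiples (hessianPoint F d)) :
    Q + Q ∉ AddSubgroup.zmultiples (hessianPoint F d) := by
  intro hm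
  obtain ⟨k, hk⟩ := AddSubgroup.mem_zmultiples_iff.1 hm
  have h3 : (3 : ℕ) • hessianPoint F d = 0 := by
    rw [← addOrderOf_hessianPoint (F := F) (d := d), addOrderOf_nsmul_eq_zero]
  have h4 : Q - (2 * k) • hessianPoint F d = 0 := by
    apply eq_zero_of_add_self_eq_zero hd h2
    have h5 : Q - (2 * k) • hessianPoint F d + (Q - (2 * k) • hessianPoint F d) =
      (Q + Q) - k • hessianPoint F d - k • ((3 : ℕ) • hessianPoint F d) := by
      module
    rw [h5, ← hk, h3, zsmul_zero, sub_zero, sub_self]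
  rw [sub_eq_zero] at h4
  exact hQ (h4 ▸ AddSubgroup.zsmul_mem_zmultiples _ _)

/-- How the depth and the naive height change under doubling. -/
theorem IsHessianTripleOf.exists_add_self {Q : (hessianCurve F d).toAffine.Point}
    {A B C C' : F[X]} (hQT : IsHessianTripleOf Q A B C C')
    (hd : 1 ≤ d) (h2 : (2 : F) ≠ 0) (h3 : (3 : F) ≠ 0)
    (hsq : Squarefree (27 * X ^ d + 1 : F[X]))
    (hQ : Q ∉ AddSubgroup.zmultiples (hessianPoint F d)) :
    ∃ A₂ B₂ C₂ C₂' : F[X], IsHessianTripleOf (Q + Q) A₂ B₂ C₂ C₂' ∧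
      nodeDepth C₂ C₂' ≤ 2 * nodeDepth C C' ∧
      nodeDepth C₂ C₂' + 2 * nodeDepth C C' ≤ 3 * d ∧
      4 * naiveHeight d A B ≤ naiveHeight d A₂ B₂ + 6 * nodeDepth C C' := by
  have hQ2 := add_self_notMem_zmultiples hd h2 hQ
  obtain ⟨hT, x, y, h, rfl, hx, hy⟩ := hQT
  obtain ⟨hm, hm0⟩ := hT.tangent_ne_zero hd h2 hx hy
  obtain ⟨x₂, y₂, h₂, l, e, hl, hx₂, hy₂⟩ := hessianCurve_add_self h hm0
  have hn : (3 * x ^ 2 - y) * ι B ^ 4 = ι (3 * A ^ 2 - C * B) := by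
    simp only [map_sub, map_mul, map_pow, map_ofNat, ← hx, ← hy]
    ring
  have hl' : l * ι (B * (C - C')) = ι (3 * A ^ 2 - C * B) := by
    rw [← hn, ← hl, map_mul, ← hm]
    ring
  have hx₂0 : x₂ ≠ 0 := by
    rintro rfl
    rw [e] at hQ2
    exact hQ2 (some_mem_zmultiples_of_x_eq_zero h₂)
  -- The cubic factor of `x(2P)` does not vanish, since `2P ∉ ⟨P₀⟩` gives `x(2P) ≠ 0`.
  have hne : A ^ 3 + X ^ d * A * B ^ 4 - 2 * (X ^ d) ^ 2 * B ^ 6 ≠ 0 := by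
    intro h0
    have h4 := hessian_double_x A B C C' (X ^ d) hT.add hT.mul
    rw [h0, mul_zero] at h4
    have h5 := congrArg ι h4
    have h6 : x₂ * ι (B * (C - C')) ^ 2 = 0 := by
      rw [map_mul] at hl' ⊢
      simp only [map_add, map_sub _ _ (2 * A * (C - C') ^ 2), map_mul, map_pow, map_ofNat,
        map_zero, ← hl', ← hx] at h5
      rw [hx₂]
      linear_combination h5
    have h7 := (mul_eq_zero.1 h6).resolve_left hx₂0
    rw [← map_pow, map_eq_zero_iff _ (RatFunc.algebraMap_injective F)] at h7
    exact pow_ne_zero 2 (mul_ne_zero hT.B_ne_zero (sub_ne_zero.2 (hT.ne hd h2))) h7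
  obtain ⟨A₂, B₂, C₂, C₂', n, m, hT₂, en, em, eB, eA, eC, b1, b2, b3⟩ :=
    hT.exists_double hd h2 h3 hsq hne
  refine ⟨A₂, B₂, C₂, C₂', ⟨hT₂, x₂, y₂, h₂, e, ?_, ?_⟩, b1, b2, b3⟩ <;>
  have hlB : l * ι B₂ = ι n := by
    rw [en, em, mul_left_comm, ← eB, map_mul, map_mul] at hl'
    apply mul_left_cancel₀ (RatFunc.algebraMap_ne_zero (pow_ne_zero (nodeDepth C C') X_ne_zero))
    rw [← hl']
    ring
  · rw [eA, hx₂]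
    simp only [map_add, map_sub, map_mul, map_pow, map_ofNat, ← hlB, ← hx, eB]
    ring
  · have e2 : C₂ = X ^ d * B₂ ^ 3 - A₂ * B₂ - C₂' := by linear_combination hT₂.add
    rw [e2, eC, eA, hy₂, hx₂]
    simp only [map_add, map_sub, map_mul, map_pow, map_ofNat, RatFunc.algebraMap_X, ← hlB, ← hx,
      ← hy, eB]
    ring

end Points

/-! ### Torsion points -/

section Torsion

open WeierstrassCurve.Affine

variable {F : Type*} [Field F] {d : ℕ}

theorem squarefree_discr_factor (hd : 1 ≤ d) (hdF : (d : F) ≠ 0) :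
    Squarefree (27 * X ^ d + 1 : F[X]) := by
  obtain ⟨k, rfl⟩ : ∃ k, d = k + 1 := ⟨d - 1, by omega⟩
  refine Separable.squarefree ?_
  have hu : Polynomial.C ((k + 1 : ℕ) : F) * Polynomial.C ((k + 1 : ℕ) : F)⁻¹ = 1 := by
    rw [← map_mul, mul_inv_cancel₀ hdF, map_one]
  refine ⟨1, -(Polynomial.C ((k + 1 : ℕ) : F)⁻¹ * X), ?_⟩
  have e : derivative (27 * X ^ (k + 1) + 1 : F[X]) =
      27 * (Polynomial.C ((k + 1 : ℕ) : F) * X ^ k) := by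
    rw [← map_ofNat (Polynomial.C : F →+* F[X]) 27, derivative_add, derivative_one,
      derivative_C_mul, derivative_X_pow, add_zero, Nat.add_sub_cancel]
  rw [e]
  linear_combination -(27 * X ^ (k + 1)) * hu

/-- The naive height of a point, with the value `0` at infinity. -/
noncomputable def pointHeight : (hessianCurve F d).toAffine.Point → ℕ
  | .zero => 0
  | .some x _ _ => ratFuncHeight d x

theorem IsHessianTripleOf.pointHeight_eq {Q : (hessianCurve F d).toAffine.Point}
    {A B C C' : F[X]} (h : IsHessianTripleOf Q A B C C') : pointHeight Q = naiveHeight d A B := by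
  obtain ⟨hT, x, y, hxy, rfl, hx, -⟩ := h
  exact hT.ratFuncHeight_eq hx

/-- The naive height minus the local correction at the node, scaled by `d` to be an integer. It
is at least multiplied by four under doubling. -/
def heightDefect (d : ℕ) (A B C C' : F[X]) : ℤ :=
  d * naiveHeight d A B - nodeDepth C C' * (3 * d - nodeDepth C C')

/-- Since the naive height is at least `2d`, a nonpositive defect implies `(d - i) (2d - i) ≤ 0`. -/
theorem le_nodeDepth_of_heightDefect_nonpos {A B C C' : F[X]} (hd : 1 ≤ d)
    (h : heightDefect d A B C C' ≤ 0) (hle : 2 * nodeDepth C C' ≤ 3 * d) : d ≤ nodeDepth C C' := by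
  rw [heightDefect] at h
  have h1 : 2 * d ≤ naiveHeight d A B := le_max_of_le_right (by omega)
  by_contra! hlt
  zify at *
  nlinarith [mul_le_mul_of_nonneg_left h1 (by positivity : (0 : ℤ) ≤ d),
    mul_pos (sub_pos.2 hlt) (by linarith : (0 : ℤ) < 2 * d - nodeDepth C C')]

variable [DecidableEq (RatFunc F)]

theorem IsHessianTripleOf.exists_two_pow_nsmul {Q : (hessianCurve F d).toAffine.Point}
    {A B C C' : F[X]} (hQT : IsHessianTripleOf Q A B C C')
    (hd : 1 ≤ d) (h2 : (2 : F) ≠ 0) (h3 : (3 : F) ≠ 0)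
    (hsq : Squarefree (27 * X ^ d + 1 : F[X]))
    (hQ : Q ∉ AddSubgroup.zmultiples (hessianPoint F d)) (N : ℕ) :
    2 ^ N • Q ∉ AddSubgroup.zmultiples (hessianPoint F d) ∧
    ∃ A₂ B₂ C₂ C₂' : F[X], IsHessianTripleOf (2 ^ N • Q) A₂ B₂ C₂ C₂' ∧
      4 ^ N * heightDefect d A B C C' ≤ heightDefect d A₂ B₂ C₂ C₂' := by
  induction N with
  | zero => exact ⟨by simpa using hQ, A, B, C, C', by simpa using hQT, by simp⟩
  | succ N ih =>
    obtain ⟨hN, A₁, B₁, C₁, C₁', hT, hle⟩ := ih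
    obtain ⟨A₂, B₂, C₂, C₂', hT₂, b1, b2, b3⟩ := hT.exists_add_self hd h2 h3 hsq hN
    have e : 2 ^ (N + 1) • Q = 2 ^ N • Q + 2 ^ N • Q := by
      rw [pow_succ, mul_two, add_nsmul]
    rw [e]
    refine ⟨add_self_notMem_zmultiples hd h2 hN, A₂, B₂, C₂, C₂', hT₂, ?_⟩
    rw [pow_succ, mul_right_comm]
    refine (mul_le_mul_of_nonneg_right hle (by norm_num)).trans ?_
    rw [heightDefect, heightDefect]
    zify at b1 b2 b3
    have b4 : (d : ℤ) * (4 * naiveHeight d A₁ B₁) ≤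
        d * (naiveHeight d A₂ B₂ + 6 * nodeDepth C₁ C₁') :=
      mul_le_mul_of_nonneg_left b3 (by positivity)
    -- With depths `i`, `j` of the point and its double, `4 i (3d - i) - 6 d i - j (3d - j)` is the
    -- product `(2 i - j) (3 d - 2 i - j)`.
    nlinarith [mul_nonneg (sub_nonneg.2 b1) (sub_nonneg.2 b2)]

/-- A positive defect would make the heights of the points `2 ^ N • Q` unbounded. -/
theorem IsHessianTripleOf.heightDefect_nonpos {Q : (hessianCurve F d).toAffine.Point}
    {A B C C' : F[X]} (hQT : IsHessianTripleOf Q A B C C')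
    (hd : 1 ≤ d) (h2 : (2 : F) ≠ 0) (h3 : (3 : F) ≠ 0)
    (hsq : Squarefree (27 * X ^ d + 1 : F[X]))
    (hQ : Q ∉ AddSubgroup.zmultiples (hessianPoint F d)) (htors : IsOfFinAddOrder Q) :
    heightDefect d A B C C' ≤ 0 := by
  by_contra! hpos
  have hfin : (Set.range fun N : ℕ => pointHeight (2 ^ N • Q)).Finite := by
    have h1 : (AddSubmonoid.multiples Q : Set (hessianCurve F d).toAffine.Point).Finite :=
      htors.finite_multiples
    refine (h1.image pointHeight).subset ?_
    rintro _ ⟨N, rfl⟩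
    exact ⟨_, ⟨2 ^ N, rfl⟩, rfl⟩
  obtain ⟨M, hM⟩ := hfin.bddAbove
  have hM' : ∀ N : ℕ, pointHeight (2 ^ N • Q) ≤ M := fun N => hM ⟨N, rfl⟩
  -- `N = d M` is large enough, as `d M < 4 ^ (d M)`.
  obtain ⟨hN, A₁, B₁, C₁, C₁', hT, hle⟩ := hQT.exists_two_pow_nsmul hd h2 h3 hsq hQ (d * M)
  obtain ⟨_, _, C₂, C₂', -, -, b2, -⟩ := hT.exists_add_self hd h2 h3 hsq hN
  have h4 := hM' (d * M)
  rw [hT.pointHeight_eq] at h4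
  have h5 : ((d * M : ℕ) : ℤ) < 4 ^ (d * M) := by
    exact_mod_cast Nat.lt_pow_self (by norm_num)
  have h6 : (4 : ℤ) ^ (d * M) ≤ 4 ^ (d * M) * heightDefect d A B C C' :=
    le_mul_of_one_le_right (by positivity) hpos
  rw [heightDefect.eq_1 d A₁] at hle
  have h7 : (d : ℤ) * naiveHeight d A₁ B₁ ≤ d * M :=
    mul_le_mul_of_nonneg_left (by exact_mod_cast h4) (by positivity)
  have h8 : (0 : ℤ) ≤ nodeDepth C₁ C₁' * (3 * d - nodeDepth C₁ C₁') :=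
    mul_nonneg (by positivity) (by omega)
  push_cast at h5
  omega

theorem mem_zmultiples_of_isOfFinAddOrder (hd : 1 ≤ d) (h2 : (2 : F) ≠ 0) (h3 : (3 : F) ≠ 0)
    (hdF : (d : F) ≠ 0) {Q : (hessianCurve F d).toAffine.Point} (htors : IsOfFinAddOrder Q) :
    Q ∈ AddSubgroup.zmultiples (hessianPoint F d) := by
  by_contra hQ
  have hsq := squarefree_discr_factor hd hdF
  obtain ⟨A, B, C, C', hT⟩ := exists_isHessianTripleOf hQ
  obtain ⟨A₂, B₂, C₂, C₂', hT₂, -, b2, -⟩ := hT.exists_add_self hd h2 h3 hsq hQ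
  have hQ₂ := add_self_notMem_zmultiples hd h2 hQ
  have hD := hT.heightDefect_nonpos hd h2 h3 hsq hQ htors
  have hD₂ := hT₂.heightDefect_nonpos hd h2 h3 hsq hQ₂ (htors.add htors)
  have k1 := le_nodeDepth_of_heightDefect_nonpos hd hD (by omega)
  have k2 := le_nodeDepth_of_heightDefect_nonpos hd hD₂ (by omega)
  have hi : nodeDepth C C' = d := by omega
  have hH : naiveHeight d A B ≤ 2 * d := by
    rw [heightDefect, hi] at hD
    have : (d : ℤ) * naiveHeight d A B ≤ d * (2 * d : ℕ) := by
      push_cast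
      linarith
    exact_mod_cast le_of_mul_le_mul_left this (by exact_mod_cast hd)
  have hA := hT.1.X_pow_dvd_A (n := d) (by omega) le_rfl
    (hi.ge.trans (min_le_left _ _)) (hi.ge.trans (min_le_right _ _))
  have hdeg := natDegree_le_of_dvd hA hT.1.A_ne_zero
  rw [natDegree_X_pow] at hdeg
  have : 3 * A.natDegree ≤ naiveHeight d A B := le_max_left _ _
  omega

end Torsion

theorem proposition1p2 (F : Type*) [Field F] [Finite F] [DecidableEq (RatFunc F)]
    (p q : ℕ) [CharP F p] (hp : 5 ≤ p) (hq : Nat.card F = q)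
    (d : ℕ) (hd : 1 ≤ d) (hdq : Nat.Coprime d q) :
    Nonempty (AddCommGroup.torsion (hessianCurve F d).toAffine.Point ≃+ ZMod 3) ∧
      AddCommGroup.torsion (hessianCurve F d).toAffine.Point =
        AddSubgroup.zmultiples (hessianPoint F d) := by
  have hprime : p.Prime := CharP.char_is_prime F p
  have hne : ∀ n : ℕ, ¬ p ∣ n → (n : F) ≠ 0 := fun n hn h => hn ((CharP.cast_eq_zero_iff F p n).1 h)
  have h2 : (2 : F) ≠ 0 := by
    exact_mod_cast hne 2 fun h => absurd (Nat.le_of_dvd (by norm_num) h) (by omega)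
  have h3 : (3 : F) ≠ 0 := by
    exact_mod_cast hne 3 fun h => absurd (Nat.le_of_dvd (by norm_num) h) (by omega)
  have hpq : p ∣ q := by
    have := Fintype.ofFinite F
    rw [← CharP.cast_eq_zero_iff F p, ← hq, Nat.card_eq_fintype_card]
    exact FiniteField.cast_card_eq_zero F
  have hdF : (d : F) ≠ 0 := hne d fun h =>
    hprime.one_lt.ne' (Nat.dvd_one.1 (hdq ▸ Nat.dvd_gcd h hpq))
  have heq : AddCommGroup.torsion (hessianCurve F d).toAffine.Point =
      AddSubgroup.zmultiples (hessianPoint F d) := by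
    refine le_antisymm (fun Q hQ => mem_zmultiples_of_isOfFinAddOrder hd h2 h3 hdF hQ) ?_
    rw [AddSubgroup.zmultiples_le]
    exact addOrderOf_pos_iff.1 (by rw [addOrderOf_hessianPoint]; norm_num)
  refine ⟨?_, heq⟩
  rw [heq]
  have hcard : Nat.card (AddSubgroup.zmultiples (hessianPoint F d)) = 3 := by
    rw [Nat.card_zmultiples, addOrderOf_hessianPoint]
  exact ⟨(hcard ▸ zmodAddCyclicAddEquiv inferInstance).symm⟩
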